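/- Let $c:\mathbb{R}^n\to\mathbb{R}^m$ be $C^2$ around a point $\bar x\in\mathbb{R}^n$, and let $h:\mathbb{R}^m\to[-\infty,+\infty]$ be lower semicontinuous and finite at $\bar c=c(\bar x)$. A vector $v$ is a regular subgradient of $h$ at $z$, written $v\in\hat\partial h(z)$, if $h(z)$ is finite and $h(y)\ge h(z)+\langle v,y-z\rangle+o(|y-z|)$ as $y\to z$. The horizon subdifferential $\partial^\infty h(\bar c)$ is the set of all limits $\lim_k\lambda_kv_k$, where $v_k\in\hat\partial h(z_k)$, $z_k\to\bar c$, $h(z_k)\to h(\bar c)$, $\lambda_k>0$ and $\lambda_k\to0$. Assume the transversality condition $$\partial^\infty h(\bar c)\cap\mathrm{Null}\big(\nabla c(\bar x)^*\big)=\{0\}.$$ Then there exist constants $\gamma,\delta>0$ such that, for every point $x$ with $|x-\bar x|\le\delta$ and every step $d\in\mathbb{R}^n$ with $|d|\le\delta$ for which $|h(c(x)+\nabla c(x)d)-h(\bar c)|<\delta$, there exists a point $x_{\mathrm{new}}\in\mathbb{R}^n$ satisfying $$|x_{\mathrm{new}}-(x+d)|\le\gamma|d|^2\quad\text{and}\quad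 h\big(c(x_{\mathrm{new}})\big)\le h\big(c(x)+\nabla c(x)d\big)+\gamma|d|^2.$$ Here $|\cdot|$ is the Euclidean norm (or the absolute value), $\nabla c(x)$ is the derivative of $c$ at $x$, and $\nabla c(\bar x)^*$ is the adjoint of $\nabla c(\bar x)$. -/

import Mathlib

/-- `v` is a regular (Fréchet) subgradient of the extended-real-valued function `h` at `x`:
`h x` is finite and `h y ≥ h x + ⟪v, y - x⟫ + o(‖y - x‖)` as `y → x`. -/
def regularSubdifferential {E : Type*} [NormedAddCommGroup E] [InnerProductSpace ℝ E]
    (h : E → EReal) (x : E) : Set E :=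
  {v | h x ≠ ⊥ ∧ h x ≠ ⊤ ∧ ∀ ε : ℝ, 0 < ε → ∀ᶠ y in nhds x,
    h x + ((inner ℝ v (y - x) - ε * ‖y - x‖ : ℝ) : EReal) ≤ h y}

/-- The horizon subdifferential of `h` at a point `x` where `h` is finite: all limits of
`l k • v k`, where `v k` is a regular subgradient of `h` at `z k`, the points `z k` converge to `x`
with `h (z k) → h x`, and the scalars `l k > 0` converge to `0`. -/
def horizonSubdifferential {E : Type*} [NormedAddCommGroup E] [InnerProductSpace ℝ E]
    (h : E → EReal) (x : E) : Set E :=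
  {y | h x ≠ ⊥ ∧ h x ≠ ⊤ ∧ ∃ (z v : ℕ → E) (l : ℕ → ℝ),
    Filter.Tendsto z Filter.atTop (nhds x) ∧
    Filter.Tendsto (fun k => h (z k)) Filter.atTop (nhds (h x)) ∧
    (∀ k, v k ∈ regularSubdifferential h (z k)) ∧
    (∀ k, 0 < l k) ∧ Filter.Tendsto l Filter.atTop (nhds 0) ∧
    Filter.Tendsto (fun k => l k • v k) Filter.atTop (nhds y)}

open Filter Topology Metric

/-! By Taylor, `u₀ = x + d` nearly solves `c u = y`, where `y = c x + fderiv ℝ c x d`: the residual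
is at most `ρ = K‖d‖²`. To repair it with control on `h`, minimise the exact penalty `‖c u - z‖ +
ε‖u - u₀‖ + f (h z)` over a product of small balls, with `f` a smoothed positive part of `h z - h
y`. The value at `(u₀, y)` is at most `(1 + ε)ρ`, so a minimiser has `u` within `(1 + ε)ρ/ε` of
`u₀`, and `h z` exceeds `h y` by no more than that.

If `c u ≠ z`, let `w` be the unit vector along `c u - z`. Stationarity in `z` gives `w = l • v` with
`v` a regular subgradient of `h` and `0 < l < 2ε`; stationarity in `u` gives `‖(fderiv ℝ c u)* w‖ ≤
ε`. For small `ε`, `exists_uniform_transversality` excludes this, so `c u = z` and `u` is the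
required point. -/

/-- A smooth, strictly increasing majorant of `2 * max t 0` whose slope lies in `(0, 2)`. -/
noncomputable def smoothPosPart (ρ t : ℝ) : ℝ := t + √(t ^ 2 + ρ ^ 2)

theorem hasDerivAt_smoothPosPart {ρ : ℝ} (hρ : 0 < ρ) (t : ℝ) :
    ∃ m : ℝ, 0 < m ∧ m < 2 ∧ HasDerivAt (smoothPosPart ρ) m t := by
  have hpos : 0 < t ^ 2 + ρ ^ 2 := by positivity
  have hs : 0 < √(t ^ 2 + ρ ^ 2) := Real.sqrt_pos.2 hpos
  have habs : |t| < √(t ^ 2 + ρ ^ 2) := by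
    rw [← Real.sqrt_sq_eq_abs]
    exact Real.sqrt_lt_sqrt (sq_nonneg _) (by nlinarith)
  obtain ⟨h1, h2⟩ := abs_lt.1 habs
  have h3 : -1 < t / √(t ^ 2 + ρ ^ 2) := by rw [lt_div_iff₀ hs]; linarith
  have h4 : t / √(t ^ 2 + ρ ^ 2) < 1 := by rw [div_lt_iff₀ hs]; linarith
  refine ⟨1 + t / √(t ^ 2 + ρ ^ 2), by linarith, by linarith, ?_⟩
  have h5 : HasDerivAt (fun t : ℝ => t ^ 2 + ρ ^ 2) (2 * t) t := by
    simpa using (hasDerivAt_pow 2 t).add_const (ρ ^ 2)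
  refine ((hasDerivAt_id t).add (h5.sqrt hpos.ne')).congr_deriv ?_
  rw [mul_div_mul_left _ _ two_ne_zero]

theorem strictMono_smoothPosPart {ρ : ℝ} (hρ : 0 < ρ) : StrictMono (smoothPosPart ρ) := by
  refine strictMono_of_deriv_pos fun t => ?_
  obtain ⟨m, hm, -, h⟩ := hasDerivAt_smoothPosPart hρ t
  rwa [h.deriv]

theorem continuous_smoothPosPart (ρ : ℝ) : Continuous (smoothPosPart ρ) := by
  unfold smoothPosPart; fun_prop

theorem smoothPosPart_zero {ρ : ℝ} (hρ : 0 ≤ ρ) : smoothPosPart ρ 0 = ρ := by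
  simp [smoothPosPart, Real.sqrt_sq hρ]

theorem smoothPosPart_nonneg (ρ t : ℝ) : 0 ≤ smoothPosPart ρ t := by
  have : |t| ≤ √(t ^ 2 + ρ ^ 2) := Real.abs_le_sqrt (by nlinarith [sq_nonneg ρ])
  unfold smoothPosPart
  linarith [neg_abs_le t]

theorem le_smoothPosPart (ρ t : ℝ) : t ≤ smoothPosPart ρ t :=
  le_add_of_nonneg_right (Real.sqrt_nonneg _)

/-! ### Existence of penalty minimisers -/

/-- Minimising over the compact truncated epigraph `g p ≤ s ≤ T` avoids extending `f` to infinite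
values; strict monotonicity of `f` then forces `s = g p` at the minimiser. -/
theorem LowerSemicontinuous.exists_forall_add_comp_le {Z : Type*} [TopologicalSpace Z]
    {g : Z → EReal} (hg : LowerSemicontinuous g) {K : Set Z} (hK : IsCompact K)
    {q : Z → ℝ} (hq : ContinuousOn q K) {f : ℝ → ℝ} (hf : Continuous f) (hmono : StrictMono f)
    {a T α : ℝ} (ha : ∀ p ∈ K, (a : EReal) ≤ g p) {p₀ : Z} (hp₀ : p₀ ∈ K) (hα : g p₀ = α)
    (hαT : α ≤ T) :
    ∃ p ∈ K, ∃ s : ℝ, g p = s ∧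
      ∀ p' ∈ K, ∀ t : ℝ, t ≤ T → g p' = t → q p + f s ≤ q p' + f t := by
  have hclosed : IsClosed {p : Z × ℝ | g p.1 ≤ (p.2 : EReal)} :=
    hg.isClosed_epigraph.preimage (continuous_id.prodMap continuous_coe_real_ereal)
  have hS : IsCompact ((K ×ˢ Set.Icc a T) ∩ {p : Z × ℝ | g p.1 ≤ (p.2 : EReal)}) :=
    (hK.prod isCompact_Icc).inter_right hclosed
  have haα : a ≤ α := by have := ha p₀ hp₀; rw [hα] at this; exact_mod_cast this
  have hcont : ContinuousOn (fun p : Z × ℝ => q p.1 + f p.2)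
      ((K ×ˢ Set.Icc a T) ∩ {p : Z × ℝ | g p.1 ≤ (p.2 : EReal)}) :=
    (hq.comp continuous_fst.continuousOn fun p hp => hp.1.1).add
      (hf.comp continuous_snd).continuousOn
  obtain ⟨⟨p, s⟩, ⟨⟨hpK, hs⟩, hgs⟩, hmin⟩ :=
    hS.exists_isMinOn ⟨(p₀, α), ⟨⟨hp₀, haα, hαT⟩, hα.le⟩⟩ hcont
  simp only [Set.mem_ofPred_eq] at hgs
  have hgp : g p = ((g p).toReal : EReal) := by
    refine (EReal.coe_toReal ?_ ?_).symm
    · exact (hgs.trans_lt (EReal.coe_lt_top s)).ne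
    · exact ((EReal.bot_lt_coe a).trans_le (ha p hpK)).ne'
  set s' := (g p).toReal with hs'
  have hs's : s' ≤ s := by rw [hgp] at hgs; exact_mod_cast hgs
  have has' : a ≤ s' := by have := ha p hpK; rw [hgp] at this; exact_mod_cast this
  have h1 : s ≤ s' := by
    have := hmin (a := (p, s')) ⟨⟨hpK, has', hs's.trans hs.2⟩, hgp.le⟩
    simp only [Set.mem_ofPred_eq, add_le_add_iff_left] at this
    exact hmono.le_iff_le.1 this
  refine ⟨p, hpK, s, by rw [hgp, le_antisymm hs's h1], fun p' hp' t ht hgt => ?_⟩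
  have hat : a ≤ t := by have := ha p' hp'; rw [hgt] at this; exact_mod_cast this
  exact hmin (a := (p', t)) ⟨⟨hp', hat, ht⟩, hgt.le⟩

/-! ### First-order conditions -/

section

variable {E F : Type*} [NormedAddCommGroup E] [InnerProductSpace ℝ E]
  [NormedAddCommGroup F] [InnerProductSpace ℝ F]

/-- A chain rule for `f ∘ h` at a minimum: were `h` to drop below the candidate minorant `τ`,
monotonicity and the expansions of `f` and `q` would contradict minimality. -/
theorem inv_smul_mem_regularSubdifferential_of_eventually_le {h : F → EReal} {z w : F}
    {s T m : ℝ} {f : ℝ → ℝ} {q : F → ℝ} (hz : h z = s) (hsT : s < T) (hmono : StrictMono f)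
    (hm : 0 < m) (hf : HasDerivAt f m s) (hq : HasFDerivAt q (-innerSL ℝ w) z)
    (hbot : ∀ᶠ y in 𝓝 z, h y ≠ ⊥)
    (hmin : ∀ᶠ y in 𝓝 z, ∀ t : ℝ, t ≤ T → h y = t → q z + f s ≤ q y + f t) :
    m⁻¹ • w ∈ regularSubdifferential h z := by
  refine ⟨by simp [hz], by simp [hz], fun ε hε => ?_⟩
  set τ : F → ℝ := fun y => s + (inner ℝ (m⁻¹ • w) (y - z) - ε * ‖y - z‖) with hτ
  have hτz : τ z = s := by simp [hτ]
  have hτc : Tendsto τ (𝓝 z) (𝓝 s) := by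
    have : Continuous τ := by fun_prop
    simpa [hτz] using this.tendsto z
  set C : ℝ := ‖m⁻¹ • w‖ + ε with hC
  have hCpos : 0 < C := by positivity
  have hτb : ∀ y, |τ y - s| ≤ C * ‖y - z‖ := fun y => by
    have h1 := abs_real_inner_le_norm (m⁻¹ • w) (y - z)
    have h2 : |ε * ‖y - z‖| = ε * ‖y - z‖ := abs_of_nonneg (by positivity)
    calc |τ y - s| = |inner ℝ (m⁻¹ • w) (y - z) - ε * ‖y - z‖| := by simp [hτ]
      _ ≤ |inner ℝ (m⁻¹ • w) (y - z)| + |ε * ‖y - z‖| := abs_sub _ _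
      _ ≤ C * ‖y - z‖ := by rw [h2, hC, add_mul]; linarith
  have hq' := hq.isLittleO.def (show 0 < m * ε / 4 by positivity)
  have hf' := hτc.eventually (hf.hasFDerivAt.isLittleO.def (show 0 < m * ε / (4 * C) by positivity))
  filter_upwards [hbot, hmin, hq', hf', hτc.eventually (gt_mem_nhds hsT)] with y h1 h2 h3 h4 h5
  by_contra! hlt
  rw [hz, ← EReal.coe_add] at hlt
  have hy : h y = ((h y).toReal : EReal) :=
    (EReal.coe_toReal (hlt.trans (EReal.coe_lt_top _)).ne h1).symm
  set t := (h y).toReal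
  have ht : t < τ y := by rw [hy] at hlt; exact_mod_cast hlt
  have h6 := h2 t (ht.trans h5).le hy
  have h7 : f t < f (τ y) := hmono ht
  have h8 : f (τ y) - f s - m * (τ y - s) ≤ m * ε / 4 * ‖y - z‖ := by
    have : f (τ y) - f s - m * (τ y - s) ≤ m * ε / (4 * C) * |τ y - s| := by
      refine (le_abs_self _).trans ?_
      simpa [mul_comm] using h4
    refine this.trans ?_
    calc m * ε / (4 * C) * |τ y - s| ≤ m * ε / (4 * C) * (C * ‖y - z‖) := by
          gcongr; exact hτb y
      _ = m * ε / 4 * ‖y - z‖ := by field_simp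
  have h9 : q y - q z + inner ℝ w (y - z) ≤ m * ε / 4 * ‖y - z‖ := by
    refine (le_abs_self _).trans ?_
    simpa only [neg_apply, innerSL_apply_apply, sub_neg_eq_add, Real.norm_eq_abs] using h3
  have h10 : m * (τ y - s) = inner ℝ w (y - z) - m * ε * ‖y - z‖ := by
    simp only [hτ, inner_smul_left]
    simp
    field_simp
  have h11 : 0 ≤ m * ε * ‖y - z‖ := by positivity
  -- The two expansion errors total `m * ε / 2 * ‖y - z‖`, less than the margin `m * ε * ‖y - z‖`
  -- built into `τ`.
  nlinarith

theorem HasFDerivAt.norm_le_of_eventually_le_add {q : E → ℝ} {L : E →L[ℝ] ℝ} {u : E} {ε : ℝ}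
    (hq : HasFDerivAt q L u) (hε : 0 ≤ ε) (hmin : ∀ᶠ x in 𝓝 u, q u ≤ q x + ε * ‖x - u‖) :
    ‖L‖ ≤ ε := by
  have key : ∀ v, -(L v) ≤ ε * ‖v‖ := fun v => by
    have hd : HasDerivAt (fun t : ℝ => q (u + t • v)) (L v) 0 := by
      have hl : HasDerivAt (fun t : ℝ => u + t • v) v 0 := by
        simpa using ((hasDerivAt_id (0 : ℝ)).smul_const v).const_add u
      have hq' : HasFDerivAt q L (u + (0 : ℝ) • v) := by simpa using hq
      exact hq'.comp_hasDerivAt 0 hl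
    have hslope := hd.tendsto_slope_zero_right
    have hcont : Tendsto (fun t : ℝ => u + t • v) (𝓝[>] 0) (𝓝 u) := by
      have : Continuous fun t : ℝ => u + t • v := by fun_prop
      simpa using (this.tendsto 0).mono_left nhdsWithin_le_nhds
    have : -(ε * ‖v‖) ≤ L v := by
      refine ge_of_tendsto hslope ?_
      filter_upwards [hcont.eventually hmin, self_mem_nhdsWithin] with t ht (ht0 : 0 < t)
      have h1 : ‖u + t • v - u‖ = t * ‖v‖ := by simp [norm_smul, _root_.abs_of_pos ht0]
      rw [h1] at ht
      simp only [zero_add, zero_smul, add_zero, smul_eq_mul]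
      rw [inv_mul_eq_div, le_div_iff₀ ht0]
      linarith
    linarith
  refine L.opNorm_le_bound hε fun v => ?_
  rw [Real.norm_eq_abs, abs_le]
  constructor
  · linarith [key v]
  · have := key (-v)
    simpa using this

theorem hasFDerivAt_norm_of_ne_zero {x : F} (hx : x ≠ 0) :
    HasFDerivAt (fun y : F => ‖y‖) (innerSL ℝ (‖x‖⁻¹ • x)) x := by
  have hn : ‖x‖ ≠ 0 := norm_ne_zero_iff.2 hx
  have h := (hasStrictFDerivAt_norm_sq x).hasFDerivAt.sqrt (by positivity)
  simp only [Real.sqrt_sq (norm_nonneg _)] at h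
  refine h.congr_fderiv ?_
  ext y
  simp
  field_simp

end

/-! ### Linearisation error -/

theorem ContDiffAt.exists_quadratic_bound {E F : Type*} [NormedAddCommGroup E] [NormedSpace ℝ E]
    [NormedAddCommGroup F] [NormedSpace ℝ F] {c : E → F} {x₀ : E} (hc : ContDiffAt ℝ 2 c x₀) :
    ∃ K r : ℝ, 0 < K ∧ 0 < r ∧ (∀ x ∈ closedBall x₀ r, DifferentiableAt ℝ c x) ∧
      ∀ x ∈ closedBall x₀ r, ∀ d, x + d ∈ closedBall x₀ r →
        ‖c (x + d) - (c x + fderiv ℝ c x d)‖ ≤ K * ‖d‖ ^ 2 := by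
  have hd : ContDiffAt ℝ 1 (fderiv ℝ c) x₀ := hc.fderiv_right (by norm_num)
  obtain ⟨K, t, ht, hlip⟩ := hd.exists_lipschitzOnWith
  have hdiff : ∀ᶠ x in 𝓝 x₀, DifferentiableAt ℝ c x :=
    (hc.eventually (by simp)).mono fun x hx => hx.differentiableAt (by norm_num)
  obtain ⟨r, hr, hball⟩ := nhds_basis_closedBall.mem_iff.1 (inter_mem ht hdiff)
  refine ⟨K + 1, r, by positivity, hr, fun x hx => (hball hx).2, fun x hx d hxd => ?_⟩
  have hseg : segment ℝ x (x + d) ⊆ closedBall x₀ r :=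
    (convex_closedBall x₀ r).segment_subset hx hxd
  have hbound : ∀ y ∈ segment ℝ x (x + d), ‖fderiv ℝ c y - fderiv ℝ c x‖ ≤ K * ‖d‖ := by
    intro y hy
    refine (hlip.norm_sub_le (hball (hseg hy)).1 (hball hx).1).trans ?_
    gcongr
    simpa using norm_sub_le_of_mem_segment hy
  have := (convex_segment x (x + d)).norm_image_sub_le_of_norm_fderiv_le'
    (fun y hy => (hball (hseg hy)).2) hbound (left_mem_segment ℝ x (x + d))
    (right_mem_segment ℝ x (x + d))
  rw [add_sub_cancel_left] at this
  rw [← sub_sub]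
  nlinarith [sq_nonneg ‖d‖]

/-! ### Transversality and the penalty argument -/

section

variable {E F : Type*} [NormedAddCommGroup E] [InnerProductSpace ℝ E] [CompleteSpace E]
  [NormedAddCommGroup F] [InnerProductSpace ℝ F] [CompleteSpace F]

/-- Otherwise violations with `ε = 1/(k+1)` have unit vectors `l k • v k` subconverging to a unit
horizon subgradient, as `l k < 2ε` tends to `0`, and the limit lies in the null space of the
adjoint. -/
theorem exists_uniform_transversality [FiniteDimensional ℝ F]
    {c : E → F} {h : F → EReal} {x₀ : E} {H : ℝ}
    (hc : ContinuousAt (fderiv ℝ c) x₀) (hH : h (c x₀) = H)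
    (htrans : ∀ y ∈ horizonSubdifferential h (c x₀),
      ContinuousLinearMap.adjoint (fderiv ℝ c x₀) y = 0 → y = 0) :
    ∃ ε : ℝ, 0 < ε ∧ ε ≤ 1 ∧ ∀ u ∈ closedBall x₀ ε, ∀ z ∈ closedBall (c x₀) ε, ∀ s : ℝ,
      h z = s → |s - H| ≤ ε → ∀ v ∈ regularSubdifferential h z, ∀ l : ℝ, 0 < l → l < 2 * ε →
      ‖l • v‖ = 1 → ε < ‖ContinuousLinearMap.adjoint (fderiv ℝ c u) (l • v)‖ := by
  by_contra! hcon
  have hpos : ∀ k : ℕ, (0 : ℝ) < 1 / ((k : ℝ) + 1) := fun k => by positivity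
  have hle : ∀ k : ℕ, 1 / ((k : ℝ) + 1) ≤ 1 := fun k => by
    rw [div_le_one (by positivity)]; linarith [k.cast_nonneg (α := ℝ)]
  choose u hu z hz s hs hsH v hv l hl hl2 hnorm hadj using fun k : ℕ => hcon _ (hpos k) (hle k)
  have hlim := tendsto_one_div_add_atTop_nhds_zero_nat (𝕜 := ℝ)
  obtain ⟨w, hw, φ, hφ, hφw⟩ := (isCompact_sphere (0 : F) 1).tendsto_subseq
    (x := fun k => l k • v k) (fun k => by simpa using hnorm k)
  have hlimφ := hlim.comp hφ.tendsto_atTop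
  have hu' : Tendsto (u ∘ φ) atTop (𝓝 x₀) :=
    tendsto_iff_dist_tendsto_zero.2 (squeeze_zero (fun _ => dist_nonneg) (fun k => hu (φ k)) hlimφ)
  have hz' : Tendsto (z ∘ φ) atTop (𝓝 (c x₀)) :=
    tendsto_iff_dist_tendsto_zero.2 (squeeze_zero (fun _ => dist_nonneg) (fun k => hz (φ k)) hlimφ)
  have hs' : Tendsto (s ∘ φ) atTop (𝓝 H) :=
    tendsto_iff_dist_tendsto_zero.2 (squeeze_zero (fun _ => dist_nonneg) (fun k => hsH (φ k)) hlimφ)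
  have hl' : Tendsto (l ∘ φ) atTop (𝓝 0) :=
    squeeze_zero (fun k => (hl (φ k)).le) (fun k => (hl2 (φ k)).le) (by simpa using hlimφ.const_mul 2)
  have hmem : w ∈ horizonSubdifferential h (c x₀) := by
    refine ⟨by simp [hH], by simp [hH], z ∘ φ, v ∘ φ, l ∘ φ, hz', ?_, fun k => hv _,
      fun k => hl _, hl', hφw⟩
    rw [hH]
    refine ((continuous_coe_real_ereal.tendsto H).comp hs').congr fun k => ?_
    simp [hs]
  have hadj' : Tendsto (fun k => ContinuousLinearMap.adjoint (fderiv ℝ c (u (φ k)))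
      (l (φ k) • v (φ k))) atTop (𝓝 (ContinuousLinearMap.adjoint (fderiv ℝ c x₀) w)) :=
    (isBoundedBilinearMap_apply.continuous.tendsto _).comp
      (((ContinuousLinearMap.adjoint.continuous.tendsto _).comp
        (hc.tendsto.comp hu')).prodMk_nhds hφw)
  have hzero : ContinuousLinearMap.adjoint (fderiv ℝ c x₀) w = 0 := by
    refine tendsto_nhds_unique hadj' (squeeze_zero_norm (fun k => hadj (φ k)) hlimφ)
  have := htrans w hmem hzero
  simp [this] at hw

theorem exists_nearby_feasible_point [FiniteDimensional ℝ E] [FiniteDimensional ℝ F]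
    {c : E → F} {h : F → EReal} {x₀ : E} {y₀ : F} {H r η ε b : ℝ}
    (hlsc : LowerSemicontinuous h) (hε : 0 < ε) (hε1 : ε ≤ 1)
    (hdiff : ∀ u ∈ closedBall x₀ r, DifferentiableAt ℝ c u)
    (hmap : ∀ u ∈ closedBall x₀ r, c u ∈ closedBall y₀ (η / 2))
    (hlow : ∀ y ∈ closedBall y₀ η, ((H - b : ℝ) : EReal) ≤ h y)
    (hreg : ∀ u ∈ closedBall x₀ r, ∀ z ∈ closedBall y₀ η, ∀ s : ℝ,
      h z = s → |s - H| ≤ b → ∀ v ∈ regularSubdifferential h z, ∀ l : ℝ, 0 < l → l < 2 * ε →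
      ‖l • v‖ = 1 → ε < ‖ContinuousLinearMap.adjoint (fderiv ℝ c u) (l • v)‖)
    {u₀ : E} {y : F} {α ρ : ℝ} (hu₀ : u₀ ∈ closedBall x₀ (r / 2)) (hy : y ∈ closedBall y₀ η)
    (hα : h y = α) (hαb : α ≤ H + b / 2) (hρ : 0 < ρ) (hcu : ‖c u₀ - y‖ ≤ ρ)
    (hρr : (1 + ε) / ε * ρ < r / 2) (hρη : (1 + ε) / ε * ρ < η / 2)
    (hρb : (1 + ε) / ε * ρ < b / 2) :
    ∃ u : E, ‖u - u₀‖ ≤ (1 + ε) / ε * ρ ∧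
      h (c u) ≤ h y + (((1 + ε) / ε * ρ : ℝ) : EReal) := by
  set κ := (1 + ε) / ε * ρ with hκ
  have hκpos : 0 < κ := by positivity
  have hεκ : ε * κ = ρ + ε * ρ := by rw [hκ]; field_simp
  have hεκ' : ρ + ε * ρ ≤ κ := by rw [← hεκ]; nlinarith
  set f : ℝ → ℝ := fun t => ε * smoothPosPart ρ (t - α) with hf
  set q : E × F → ℝ := fun p => ‖c p.1 - p.2‖ + ε * ‖p.1 - u₀‖ with hq
  have hfmono : StrictMono f := fun s t hst =>
    mul_lt_mul_of_pos_left (strictMono_smoothPosPart hρ (by linarith)) hε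
  have hfcont : Continuous f := by
    have := continuous_smoothPosPart ρ
    fun_prop
  have hccont : ContinuousOn c (closedBall x₀ r) := fun u hu =>
    (hdiff u hu).continuousAt.continuousWithinAt
  have hqcont : ContinuousOn q (closedBall x₀ r ×ˢ closedBall y₀ η) := by
    have h1 : ContinuousOn (fun p : E × F => c p.1) (closedBall x₀ r ×ˢ closedBall y₀ η) :=
      hccont.comp continuous_fst.continuousOn fun p hp => hp.1
    exact (h1.sub continuous_snd.continuousOn).norm.add (by fun_prop)
  have hu₀r : u₀ ∈ closedBall x₀ r := closedBall_subset_closedBall (by linarith) hu₀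
  obtain ⟨⟨u, z⟩, ⟨hu, hz⟩, s, hs, hmin⟩ :=
    (hlsc.comp continuous_snd).exists_forall_add_comp_le (g := fun p : E × F => h p.2)
      ((isCompact_closedBall x₀ r).prod (isCompact_closedBall y₀ η)) hqcont hfcont hfmono
      (T := H + b) (fun p hp => hlow _ hp.2) (p₀ := (u₀, y)) ⟨hu₀r, hy⟩ hα (by linarith)
  simp only at hu hz hs
  have hstart : ‖c u - z‖ + ε * ‖u - u₀‖ + f s ≤ ρ + ε * ρ := by
    refine (hmin (u₀, y) ⟨hu₀r, hy⟩ α (by linarith) hα).trans ?_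
    simp [hq, hf, smoothPosPart_zero hρ.le, hcu]
  have hfs : 0 ≤ f s := mul_nonneg hε.le (smoothPosPart_nonneg _ _)
  have hfs' : ε * (s - α) ≤ f s := mul_le_mul_of_nonneg_left (le_smoothPosPart _ _) hε.le
  have hn1 := norm_nonneg (c u - z)
  have hn2 : 0 ≤ ε * ‖u - u₀‖ := by positivity
  have huκ : ‖u - u₀‖ ≤ κ := le_of_mul_le_mul_left (by linarith) hε
  have hsκ : s - α ≤ κ := le_of_mul_le_mul_left (by linarith) hε
  have hcz : c u = z := by
    by_contra hne
    have hne' : c u - z ≠ 0 := sub_ne_zero.2 hne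
    set w : F := ‖c u - z‖⁻¹ • (c u - z) with hw
    have hwnorm : ‖w‖ = 1 := norm_smul_inv_norm (𝕜 := ℝ) hne'
    have huint : closedBall x₀ r ∈ 𝓝 u := by
      refine closedBall_mem_nhds_of_mem (mem_ball.2 ?_)
      have h1 : dist u u₀ ≤ κ := by rwa [dist_eq_norm]
      linarith [dist_triangle u u₀ x₀, mem_closedBall.1 hu₀]
    have hzint : closedBall y₀ η ∈ 𝓝 z := by
      refine closedBall_mem_nhds_of_mem (mem_ball.2 ?_)
      have h1 : dist z (c u) ≤ κ := by rw [dist_comm, dist_eq_norm]; linarith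
      linarith [dist_triangle z (c u) y₀, mem_closedBall.1 (hmap u hu)]
    have hsH : |s - H| ≤ b := by
      have h1 := hlow z hz
      rw [hs] at h1
      have h2 : H - b ≤ s := by exact_mod_cast h1
      rw [abs_le]
      constructor <;> linarith
    obtain ⟨m, hm, hm2, hderiv⟩ := hasDerivAt_smoothPosPart hρ (s - α)
    have hfderiv : HasDerivAt f (ε * m) s := (hderiv.comp_sub_const s α).const_mul ε
    have hnorm := hasFDerivAt_norm_of_ne_zero hne'
    have hzderiv : HasFDerivAt (fun y => ‖c u - y‖) (-innerSL ℝ w) z := by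
      refine (hnorm.comp z ((hasFDerivAt_id z).const_sub (c u))).congr_fderiv ?_
      ext y; simp [hw]
    have hmem : (ε * m)⁻¹ • w ∈ regularSubdifferential h z := by
      refine inv_smul_mem_regularSubdifferential_of_eventually_le hs (T := H + b) (by linarith)
        hfmono (by positivity) hfderiv hzderiv ?_ ?_
      · filter_upwards [hzint] with y hy
        exact ((EReal.bot_lt_coe _).trans_le (hlow y hy)).ne'
      · filter_upwards [hzint] with y hy t ht hyt
        have := hmin (u, y) ⟨hu, hy⟩ t ht hyt
        simp only [hq] at this
        linarith
    have hεm : ε * m ≠ 0 := by positivity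
    -- The slope bound `m < 2` supplies `l = ε * m < 2 * ε`.
    have hlt := hreg u hu z hz s hs hsH _ hmem (ε * m) (by positivity) (by nlinarith)
      (by rw [smul_inv_smul₀ hεm, hwnorm])
    rw [smul_inv_smul₀ hεm] at hlt
    have huderiv : HasFDerivAt (fun x => ‖c x - z‖) ((innerSL ℝ w).comp (fderiv ℝ c u)) u :=
      hnorm.comp u ((hdiff u hu).hasFDerivAt.sub_const z)
    have hle := huderiv.norm_le_of_eventually_le_add hε.le (by
      filter_upwards [huint] with x hx
      have h1 := hmin (x, z) ⟨hx, hz⟩ s (by linarith) hs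
      have h2 : ‖x - u₀‖ ≤ ‖x - u‖ + ‖u - u₀‖ := norm_sub_le_norm_sub_add_norm_sub _ _ _
      simp only [hq] at h1
      nlinarith)
    have heq : (innerSL ℝ w).comp (fderiv ℝ c u) =
        innerSL ℝ (ContinuousLinearMap.adjoint (fderiv ℝ c u) w) := by
      ext x; simp [ContinuousLinearMap.adjoint_inner_left]
    rw [heq, innerSL_apply_norm] at hle
    linarith
  refine ⟨u, huκ, ?_⟩
  rw [hcz, hs, hα, ← EReal.coe_add, EReal.coe_le_coe_iff]
  linarith

end

/-! ### Choice of constants and conclusion -/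

theorem EReal.exists_coe_of_abs_sub_lt {x : EReal} {a δ : ℝ}
    (h : (x - (a : EReal)).abs < ENNReal.ofReal δ) : ∃ t : ℝ, x = t ∧ |t - a| < δ := by
  induction x with
  | bot => simp at h
  | top => simp at h
  | coe t =>
    rw [← EReal.coe_sub, EReal.abs_def] at h
    exact ⟨t, rfl, (ENNReal.ofReal_lt_ofReal_iff_of_nonneg (abs_nonneg _)).1 h⟩

theorem mainTheorem2 (n m : ℕ)
    (c : EuclideanSpace ℝ (Fin n) → EuclideanSpace ℝ (Fin m))
    (h : EuclideanSpace ℝ (Fin m) → EReal)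
    (xbar : EuclideanSpace ℝ (Fin n))
    (hc : ContDiffAt ℝ 2 c xbar)
    (hlsc : LowerSemicontinuous h)
    (hbot : h (c xbar) ≠ ⊥) (htop : h (c xbar) ≠ ⊤)
    (htrans : horizonSubdifferential h (c xbar) ∩
      {y | ContinuousLinearMap.adjoint (fderiv ℝ c xbar) y = 0} = {0}) :
    ∃ γ δ : ℝ, 0 < γ ∧ 0 < δ ∧
      ∀ x ∈ Metric.closedBall xbar δ,
      ∀ d ∈ Metric.closedBall (0 : EuclideanSpace ℝ (Fin n)) δ,
        (h (c x + fderiv ℝ c x d) - h (c xbar)).abs < ENNReal.ofReal δ →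
        ∃ xnew : EuclideanSpace ℝ (Fin n),
          ‖xnew - (x + d)‖ ≤ γ * ‖d‖ ^ 2 ∧
          h (c xnew) ≤ h (c x + fderiv ℝ c x d) + ((γ * ‖d‖ ^ 2 : ℝ) : EReal) := by
  obtain ⟨H, hH⟩ : ∃ H : ℝ, h (c xbar) = H := ⟨_, (EReal.coe_toReal htop hbot).symm⟩
  have hfd : ContinuousAt (fderiv ℝ c) xbar :=
    (hc.fderiv_right (m := 1) (by norm_num)).continuousAt
  obtain ⟨ε, hε, hε1, hreg⟩ := exists_uniform_transversality hfd hH fun y hy h0 => by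
    have : y ∈ horizonSubdifferential h (c xbar) ∩
      {y | ContinuousLinearMap.adjoint (fderiv ℝ c xbar) y = 0} := ⟨hy, h0⟩
    rwa [htrans] at this
  obtain ⟨K, r₁, hK, hr₁, hdiff, hquad⟩ := hc.exists_quadratic_bound
  have hlow : ∀ᶠ y in 𝓝 (c xbar), ((H - ε : ℝ) : EReal) ≤ h y :=
    (hlsc (c xbar) _ (show _ < h (c xbar) by rw [hH]; exact_mod_cast sub_lt_self H hε)).mono fun _ => le_of_lt
  obtain ⟨η₁, hη₁, hlow⟩ := nhds_basis_closedBall.mem_iff.1 hlow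
  set η := min η₁ ε
  have hη : 0 < η := lt_min hη₁ hε
  obtain ⟨r₂, hr₂, hmap⟩ := nhds_basis_closedBall.mem_iff.1
    (hc.continuousAt.preimage_mem_nhds (closedBall_mem_nhds (c xbar) (half_pos hη)))
  set r := min (min r₁ r₂) ε
  have hr : 0 < r := lt_min (lt_min hr₁ hr₂) hε
  have hrr₁ : r ≤ r₁ := (min_le_left _ _).trans (min_le_left _ _)
  have hrr₂ : r ≤ r₂ := (min_le_left _ _).trans (min_le_right _ _)
  set γ := (1 + ε) / ε * K with hγ
  have hγpos : 0 < γ := by positivity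
  have hsq : ∀ᶠ δ : ℝ in 𝓝[>] 0, γ * δ ^ 2 < min (r / 2) (η / 2) := by
    have : Tendsto (fun δ : ℝ => γ * δ ^ 2) (𝓝[>] 0) (𝓝 0) := by
      have h1 : Continuous fun δ : ℝ => γ * δ ^ 2 := by fun_prop
      simpa using (h1.tendsto 0).mono_left nhdsWithin_le_nhds
    exact this.eventually (gt_mem_nhds (lt_min (half_pos hr) (half_pos hη)))
  -- `r / 4` puts `x + d` within `r / 2` of `xbar`; `ε / 2` gives `α ≤ H + ε / 2`.
  have hsmall : ∀ᶠ δ : ℝ in 𝓝[>] 0, δ < min (r / 4) (ε / 2) :=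
    mem_nhdsWithin_of_mem_nhds (gt_mem_nhds (lt_min (by positivity) (by positivity)))
  obtain ⟨δ, ⟨hsq, hsmall⟩, hδ : 0 < δ⟩ :=
    ((hsq.and hsmall).and self_mem_nhdsWithin).exists
  rw [lt_min_iff] at hsq hsmall
  have hηε : η ≤ ε := min_le_right _ _
  refine ⟨γ, δ, hγpos, hδ, fun x hx d hd habs => ?_⟩
  rw [hH] at habs
  obtain ⟨α, hα, hαH⟩ := EReal.exists_coe_of_abs_sub_lt habs
  -- The smoothing needs `ρ = K * ‖d‖ ^ 2 > 0`, so `d = 0` is separate.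
  rcases eq_or_ne d 0 with rfl | hd0
  · exact ⟨x, by simp, by simp⟩
  have hdpos : 0 < ‖d‖ := norm_pos_iff.2 hd0
  have hdδ : ‖d‖ ≤ δ := by simpa using hd
  have hxr : dist x xbar ≤ δ := hx
  have hxd : dist (x + d) xbar ≤ r / 2 := by
    have : dist (x + d) x = ‖d‖ := by simp
    linarith [dist_triangle (x + d) x xbar]
  have hquad' := hquad x (mem_closedBall.2 (by linarith)) d (mem_closedBall.2 (by linarith))
  have hκ : (1 + ε) / ε * (K * ‖d‖ ^ 2) = γ * ‖d‖ ^ 2 := by rw [hγ]; ring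
  have hγd : γ * ‖d‖ ^ 2 ≤ γ * δ ^ 2 := by gcongr
  have hKd : K * ‖d‖ ^ 2 ≤ γ * ‖d‖ ^ 2 := by
    rw [← hκ]
    refine le_mul_of_one_le_left (by positivity) ?_
    rw [one_le_div hε]; linarith
  have hy : c x + fderiv ℝ c x d ∈ closedBall (c xbar) η := by
    have h1 : dist (c (x + d)) (c xbar) ≤ η / 2 :=
      hmap (mem_closedBall.2 (by linarith))
    have h2 : dist (c x + fderiv ℝ c x d) (c (x + d)) ≤ K * ‖d‖ ^ 2 := by
      rwa [dist_comm, dist_eq_norm]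
    rw [mem_closedBall]
    linarith [dist_triangle (c x + fderiv ℝ c x d) (c (x + d)) (c xbar)]
  have := exists_nearby_feasible_point (c := c) (h := h) (x₀ := xbar) (y₀ := c xbar) (H := H)
    (r := r) (η := η) (ε := ε) (b := ε) (u₀ := x + d) (ρ := K * ‖d‖ ^ 2) hlsc hε hε1
    (fun u hu => hdiff u (closedBall_subset_closedBall hrr₁ hu))
    (fun u hu => hmap (closedBall_subset_closedBall hrr₂ hu))
    (fun y hy => hlow (closedBall_subset_closedBall (min_le_left _ _) hy))
    (fun u hu z hz => hreg u (closedBall_subset_closedBall (min_le_right _ _) hu) z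
      (closedBall_subset_closedBall hηε hz))
    hxd hy hα (by linarith [(abs_lt.1 hαH).2]) (by positivity) hquad'
  rw [hκ] at this
  exact this (by linarith) (by linarith) (by linarith)
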